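/- Let $K$ be a field of characteristic $0$ (for instance $\mathbb C$, or a field of rational functions in $r,q$), and let $r,q\in K$ with $r\neq 0$, $q\ne 0$, $q^2\neq 1$. For $n\ge 0$ let $\hat{\mathcal C}_n(r,q)$ be the $K$-algebra with invertible generators $T_1,\dots,T_{n-1}$, the braid relations $T_iT_{i+1}T_i=T_{i+1}T_iT_{i+1}$, $T_iT_j=T_jT_i$ for $|i-j|>1$, and the relations $E_iT_i=r^{-1}E_i$, $E_iT_{i-1}^{\pm1}E_i=r^{\pm1}E_i$, where $E_i$ is defined by $(q-q^{-1})(1-E_i)=T_i-T_i^{-1}$. Put $x=\frac{r-r^{-1}}{q-q^{-1}}+1$. If $x\ne0$, let $tr$ be the Markov trace on the tower $\hat{\mathcal C}_0(r,q)\to\hat{\mathcal C}_1(r,q)\to\cdots$ (with the standard maps $T_i\mapsto T_i$), i.e. the trace functional determined by $tr(1)=1$, $tr(T_n)=r/x$, $tr(E_n)=1/x$ and $tr(a\chi b)=tr(ab)\,tr(\chi)$ for $a,b\in\hat{\mathcal C}_n(r,q)$, $\chi\in\{1,T_n,E_n\}$. Label simple modules by Young diagrams as follows. The label of a simple $\hat{\mathcal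 C}_n(r,q)$-module is a diagram $\lambda$ with $n,n-2,n-4,\dots$ boxes. For $n=0$ the label is $\emptyset$. For $n\ge1$, a simple module has label $\lambda$ if its restriction to $\hat{\mathcal C}_{n-1}(r,q)$ is a direct sum of simple modules, one with label $\mu$ for each $\mu$ obtained from $\lambda$ by removing a box or, if $|\lambda|<n$, by adding a box; for $n=2$ it is required in addition that $T_1$ acts by $q$, $-q^{-1}$, $r^{-1}$ if $\lambda=[2]$, $[1^2]$, $\emptyset$, respectively. Let $\hat{\mathcal C}_n(r,q)_\lambda$ be the sum of all minimal left ideals with label $\lambda$; if $\hat{\mathcal C}_n(r,q)$ is semisimple, this is its simple component labeled by $\lambda$. Let $\lambda'$ be the transpose of $\lambda$. (a) For each $n$ there is an isomorphism of $K$-algebras $\varphi_n:\hat{\mathcal C}_n(-r^{-1},q)\to\hat{\mathcal C}_n(r,q)$ with $\varphi_n(T_i)=-T_i^{-1}$ for all $i$. It maps $\hat{\mathcal C}_n(-r^{-1},q)_\lambda$ onto $\hat{\mathcal C}_n(r,q)_{\lambda'}$ for every $\lambda$ and, if $x\neq0$, it preserves the Markov trace: $tr(\varphi_n(a))=tr(a)$.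 For a root of unity $q$ and an integer $M$ put $\hat{\mathcal C}_n(M,\ell)=\hat{\mathcal C}_n(q^{M-1},q)$, and let $\bar{\mathcal C}_n(M,\ell)$ be its quotient by the annihilator ideal $\{a: tr(ab)=0\text{ for all }b\}$; here $q$ is a primitive $2\ell$-th root of unity in (b) and a primitive $4\ell$-th root of unity in (c). (b) Let $q$ be a primitive $2\ell$-th root of unity and $1<M<\ell$. Then $T_i\mapsto -T_i^{-1}$ defines trace preserving isomorphisms $\hat{\mathcal C}_n(M,\ell)\cong\hat{\mathcal C}_n(\ell+2-M,\ell)$ for all $n$, which induce isomorphisms $\bar{\mathcal C}_n(M,\ell)\cong\bar{\mathcal C}_n(\ell+2-M,\ell)$. The standard maps $\hat{\mathcal C}_n\to\hat{\mathcal C}_{n+1}$ induce inclusions $\bar{\mathcal C}_n(M,\ell)\subset\bar{\mathcal C}_{n+1}(M,\ell)$, and likewise for $\ell+2-M$, and the isomorphisms are compatible with these inclusions. (c) Let $q$ be a primitive $4\ell$-th root of unity and let $M$ be an even integer with $-2\ell<M<-1$ and $M\neq 2-2\ell$. Then the same statements hold for $\bar{\mathcal C}_n(M,\ell)$ and $\bar{\mathcal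 C}_n(-2\ell+|M|+2,\ell)$. -/

import Mathlib

/-!
The algebras `Ĉ_n(r,q)` (the q-version of Brauer's centralizer algebras), their Markov trace, the
quotients `C̄_n(M)` by the annihilator of the trace, and the labeling of simple components by
Young diagrams.
-/

universe u

noncomputable section

namespace QBrauer

/-- The index set `{1, …, n-1}` of the generators on `n` strands. -/
abbrev Idx (n : ℕ) : Type := {i : ℕ // 1 ≤ i ∧ i < n}

/-- Letters for the generators `T_i` and their inverses. -/
inductive Letter (n : ℕ) : Type
  | pos (i : Idx n) : Letter n
  | neg (i : Idx n) : Letter n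

variable {K : Type u} [Field K]

/-- The letter `T_i` in the free algebra. -/
def freeT (K : Type u) [Field K] {n : ℕ} (i : Idx n) : FreeAlgebra K (Letter n) :=
  FreeAlgebra.ι K (Letter.pos i)

/-- The letter `T_i⁻¹` in the free algebra. -/
def freeTinv (K : Type u) [Field K] {n : ℕ} (i : Idx n) : FreeAlgebra K (Letter n) :=
  FreeAlgebra.ι K (Letter.neg i)

/-- The element `E_i`, determined by `(q - q⁻¹) (1 - E_i) = T_i - T_i⁻¹`. -/
def freeE (q : K) {n : ℕ} (i : Idx n) : FreeAlgebra K (Letter n) :=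
  1 - (q - q⁻¹)⁻¹ • (freeT K i - freeTinv K i)

/-- The defining relations of `Ĉ_n(r,q)`. -/
inductive Rel (r q : K) (n : ℕ) :
    FreeAlgebra K (Letter n) → FreeAlgebra K (Letter n) → Prop
  | mul_inv (i : Idx n) : Rel r q n (freeT K i * freeTinv K i) 1
  | inv_mul (i : Idx n) : Rel r q n (freeTinv K i * freeT K i) 1
  | braid (i j : Idx n) (h : j.1 = i.1 + 1) :
      Rel r q n (freeT K i * freeT K j * freeT K i) (freeT K j * freeT K i * freeT K j)
  | comm (i j : Idx n) (h : i.1 + 1 < j.1) :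
      Rel r q n (freeT K i * freeT K j) (freeT K j * freeT K i)
  | untwist (i : Idx n) : Rel r q n (freeE q i * freeT K i) (r⁻¹ • freeE q i)
  | curl_pos (i j : Idx n) (h : i.1 = j.1 + 1) :
      Rel r q n (freeE q i * freeT K j * freeE q i) (r • freeE q i)
  | curl_neg (i j : Idx n) (h : i.1 = j.1 + 1) :
      Rel r q n (freeE q i * freeTinv K j * freeE q i) (r⁻¹ • freeE q i)

/-- The algebra `Ĉ_n(r,q)` on `n` strands. -/
def CHat (r q : K) (n : ℕ) : Type u := RingQuot (Rel r q n)

instance (r q : K) (n : ℕ) : Ring (CHat r q n) := inferInstanceAs (Ring (RingQuot (Rel r q n)))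

instance (r q : K) (n : ℕ) : Algebra K (CHat r q n) :=
  inferInstanceAs (Algebra K (RingQuot (Rel r q n)))

/-- The projection of the free algebra onto `Ĉ_n(r,q)`. -/
def proj (r q : K) (n : ℕ) : FreeAlgebra K (Letter n) →ₐ[K] CHat r q n :=
  RingQuot.mkAlgHom K (Rel r q n)

theorem proj_rel {r q : K} {n : ℕ} {a b : FreeAlgebra K (Letter n)} (h : Rel r q n a b) :
    proj r q n a = proj r q n b := RingQuot.mkAlgHom_rel K h

/-- The generator `T_i` of `Ĉ_n(r,q)`. -/
def T (r q : K) {n : ℕ} (i : Idx n) : CHat r q n := proj r q n (freeT K i)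

/-- The inverse `T_i⁻¹` of the generator `T_i`. -/
def Tinv (r q : K) {n : ℕ} (i : Idx n) : CHat r q n := proj r q n (freeTinv K i)

/-- The element `E_i` of `Ĉ_n(r,q)`. -/
def E (r q : K) {n : ℕ} (i : Idx n) : CHat r q n := proj r q n (freeE q i)

/-- The inclusion `{1, …, n-1} ⊆ {1, …, n}`. -/
def Idx.up {n : ℕ} (i : Idx n) : Idx (n + 1) := ⟨i.1, i.2.1, i.2.2.trans n.lt_succ_self⟩

/-- The standard homomorphism on letters. -/
def inclFree (r q : K) (n : ℕ) : FreeAlgebra K (Letter n) →ₐ[K] CHat r q (n + 1) :=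
  FreeAlgebra.lift K fun
    | Letter.pos i => T r q i.up
    | Letter.neg i => Tinv r q i.up

theorem inclFree_T (r q : K) {n : ℕ} (i : Idx n) :
    inclFree r q n (freeT K i) = proj r q (n + 1) (freeT K i.up) := by
  simp [inclFree, freeT, T]

theorem inclFree_Tinv (r q : K) {n : ℕ} (i : Idx n) :
    inclFree r q n (freeTinv K i) = proj r q (n + 1) (freeTinv K i.up) := by
  simp [inclFree, freeTinv, Tinv]

theorem inclFree_E (r q : K) {n : ℕ} (i : Idx n) :
    inclFree r q n (freeE q i) = proj r q (n + 1) (freeE q i.up) := by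
  simp only [freeE, map_sub, map_one, map_smul, inclFree_T, inclFree_Tinv]

theorem inclFree_rel (r q : K) (n : ℕ) ⦃a b : FreeAlgebra K (Letter n)⦄ (h : Rel r q n a b) :
    inclFree r q n a = inclFree r q n b := by
  cases h <;>
    simp only [map_mul, map_one, map_smul, inclFree_T, inclFree_Tinv, inclFree_E] <;>
    simp only [← map_mul, ← map_smul, ← map_one (proj r q (n + 1))] <;>
    apply proj_rel
  · exact Rel.mul_inv _
  · exact Rel.inv_mul _
  · exact Rel.braid _ _ ‹_›
  · exact Rel.comm _ _ ‹_›
  · exact Rel.untwist _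
  · exact Rel.curl_pos _ _ ‹_›
  · exact Rel.curl_neg _ _ ‹_›

/-- The standard homomorphism `Ĉ_n(r,q) → Ĉ_{n+1}(r,q)`, `T_i ↦ T_i`. -/
def incl (r q : K) (n : ℕ) : CHat r q n →ₐ[K] CHat r q (n + 1) :=
  RingQuot.liftAlgHom K ⟨inclFree r q n, inclFree_rel r q n⟩

/-! ### The Markov trace -/

/-- The parameter `x = (r - r⁻¹)/(q - q⁻¹) + 1`. -/
def xParam (r q : K) : K := (r - r⁻¹) / (q - q⁻¹) + 1

/-- The last generator index `n` of `Ĉ_{n+1}(r,q)`, for `n ≥ 1`. -/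
def Idx.last {n : ℕ} (hn : 1 ≤ n) : Idx (n + 1) := ⟨n, hn, n.lt_succ_self⟩

/-- The inductive characterization of the trace functional on the tower `Ĉ_0 → Ĉ_1 → ⋯`:
`tr(1) = 1` and `tr(a χ b) = tr(ab) tr(χ)` for `a, b ∈ Ĉ_n`, `χ ∈ {1, T_n, E_n}`,
where `tr(T_n) = r/x` and `tr(E_n) = 1/x`. -/
structure IsMarkovTrace (r q : K) (tr : ∀ n, CHat r q n →ₗ[K] K) : Prop where
  tr_mul_comm : ∀ n (a b : CHat r q n), tr n (a * b) = tr n (b * a)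
  tr_one : ∀ n, tr n 1 = 1
  tr_incl : ∀ n (a : CHat r q n), tr (n + 1) (incl r q n a) = tr n a
  tr_mul_T_mul : ∀ n (hn : 1 ≤ n) (a b : CHat r q n),
    tr (n + 1) (incl r q n a * T r q (Idx.last hn) * incl r q n b) =
      tr n (a * b) * (r / xParam r q)
  tr_mul_E_mul : ∀ n (hn : 1 ≤ n) (a b : CHat r q n),
    tr (n + 1) (incl r q n a * E r q (Idx.last hn) * incl r q n b) =
      tr n (a * b) * (1 / xParam r q)

open Classical in
/-- The Markov trace `tr` of the algebras `Ĉ_n(r,q)`: the functional characterized by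
`IsMarkovTrace` (a meaningful notion only if `x ≠ 0`; the zero functional if there is none). -/
def markovTrace (r q : K) : ∀ n, CHat r q n →ₗ[K] K :=
  if h : ∃ tr, IsMarkovTrace r q tr then h.choose else 0

theorem markovTrace_comm (r q : K) (n : ℕ) (a b : CHat r q n) :
    markovTrace r q n (a * b) = markovTrace r q n (b * a) := by
  unfold markovTrace
  split_ifs with h
  · exact h.choose_spec.tr_mul_comm n a b
  · simp

/-- The annihilator ideal `{a | tr(ab) = 0 for all b}` of the trace. -/
def annIdeal (r q : K) (n : ℕ) : Ideal (CHat r q n) where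
  carrier := {a | ∀ b, markovTrace r q n (a * b) = 0}
  add_mem' ha hb c := by rw [add_mul, map_add, ha c, hb c, add_zero]
  zero_mem' b := by rw [zero_mul, map_zero]
  smul_mem' c a ha b := by
    rw [smul_eq_mul, mul_assoc, markovTrace_comm, mul_assoc]
    exact ha (b * c)

instance (r q : K) (n : ℕ) : (annIdeal r q n).IsTwoSided where
  mul_mem_of_left {a} b ha := fun c => by rw [mul_assoc]; exact ha (b * c)

/-- The algebra `Ĉ_n(M,ℓ) = Ĉ_n(q^{M-1}, q)`; the level `ℓ` enters through the order of the root
of unity `q`. -/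
abbrev CHatLevel (q : K) (M : ℤ) (n : ℕ) : Type u := CHat (q ^ (M - 1)) q n

/-- The quotient `C̄_n(M,ℓ)` of `Ĉ_n(M,ℓ)` by the annihilator ideal of the Markov trace. -/
abbrev CBar (q : K) (M : ℤ) (n : ℕ) : Type u :=
  CHatLevel q M n ⧸ annIdeal (q ^ (M - 1)) q n

/-- The quotient map `Ĉ_n(M,ℓ) → C̄_n(M,ℓ)`. -/
abbrev toCBar (q : K) (M : ℤ) (n : ℕ) : CHatLevel q M n →ₐ[K] CBar q M n :=
  Ideal.Quotient.mkₐ K (annIdeal (q ^ (M - 1)) q n)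

/-- `j` is the tower of standard inclusions `C̄_n(M,ℓ) ⊆ C̄_{n+1}(M,ℓ)`, i.e. each `j n` is injective
and is induced by the standard homomorphism `Ĉ_n(M,ℓ) → Ĉ_{n+1}(M,ℓ)`. -/
def IsStandardInclusion (q : K) (M : ℤ) (j : ∀ n, CBar q M n →ₐ[K] CBar q M (n + 1)) : Prop :=
  ∀ n, Function.Injective (j n) ∧
    ∀ a, j n (toCBar q M n a) = toCBar q M (n + 1) (incl (q ^ (M - 1)) q n a)

/-! ### Labeling of simple components by Young diagrams -/

/-- The Young diagram `[2]` (one row). -/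
def rowTwo : YoungDiagram := YoungDiagram.ofRowLens [2] (by decide)

/-- The Young diagram `[1²]` (one column). -/
def colTwo : YoungDiagram := YoungDiagram.ofRowLens [1, 1] (by decide)

/-- `nu` is obtained from `mu` by adding a box. -/
def AddsBox (mu nu : YoungDiagram) : Prop := mu ≤ nu ∧ nu.card = mu.card + 1

/-- `mu` occurs in the restriction from `n` to `n - 1` strands of the module labeled by `lam`:
`mu` is obtained from `lam` by removing a box or, if `lam` has less than `n` boxes, by adding
a box. -/
def Restricts (n : ℕ) (lam mu : YoungDiagram) : Prop :=
  AddsBox mu lam ∨ (lam.card < n ∧ AddsBox lam mu)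

/-- The simple `Ĉ_n(r,q)`-module `M` is labeled by the Young diagram `lam`.  The label, a diagram
with `n, n-2, n-4, …` boxes, is determined inductively by the restriction rule: as a module over
`n` strands a module on `n + 1` strands with label `lam` is the direct sum of simple modules, one
with label `mu` for each `mu` with `Restricts (n + 1) lam mu`.  On two strands, where the three
one-dimensional modules have the same restriction, the labels `[2]`, `[1²]`, `∅` correspond to the
eigenvalues `q`, `-q⁻¹`, `r⁻¹` of `T_1`. -/
def HasLabel (r q : K) : (n : ℕ) → YoungDiagram → (M : Type u) → [AddCommGroup M] →
    [Module (CHat r q n) M] → Prop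
  | 0, lam, M, _, _ => IsSimpleModule (CHat r q 0) M ∧ lam = ⊥
  | n + 1, lam, M, _, _ =>
      IsSimpleModule (CHat r q (n + 1)) M ∧
      (∃ k, lam.card + 2 * k = n + 1) ∧
      (n + 1 = 2 → ∀ (i : Idx (n + 1)) (v : M),
        (lam = rowTwo → T r q i • v = algebraMap K (CHat r q (n + 1)) q • v) ∧
        (lam = colTwo → T r q i • v = algebraMap K (CHat r q (n + 1)) (-q⁻¹) • v) ∧
        (lam = ⊥ → T r q i • v = algebraMap K (CHat r q (n + 1)) r⁻¹ • v)) ∧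
      letI : Module (CHat r q n) M := Module.compHom M (incl r q n).toRingHom
      ∃ N : {mu // Restricts (n + 1) lam mu} → Submodule (CHat r q n) M,
        iSupIndep N ∧ iSup N = ⊤ ∧ ∀ mu, HasLabel r q n mu.1 (N mu)

/-- The component `Ĉ_n(r,q)_λ`: the sum of all minimal left ideals of `Ĉ_n(r,q)` that are labeled
by `λ`.  If `Ĉ_n(r,q)` is semisimple, this is the simple component (isotypic component of the
regular module) labeled by `λ`. -/
def component (r q : K) (n : ℕ) (lam : YoungDiagram) : Ideal (CHat r q n) :=
  sSup {L : Ideal (CHat r q n) | HasLabel r q n lam L}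

/-- The map `T_i ↦ -T_i⁻¹` gives trace preserving isomorphisms `Ĉ_n(M,ℓ) ≅ Ĉ_n(M',ℓ)`, which
induce isomorphisms `C̄_n(M,ℓ) ≅ C̄_n(M',ℓ)` that are compatible with the standard inclusions. -/
def LevelRankIso (q : K) (M M' : ℤ) : Prop :=
  ∃ φ : ∀ n, CHatLevel q M n ≃ₐ[K] CHatLevel q M' n,
    (∀ n (i : Idx n), φ n (T _ q i) = -Tinv _ q i) ∧
    (∀ n a, markovTrace _ q n (φ n a) = markovTrace _ q n a) ∧
    ∃ Φ : ∀ n, CBar q M n ≃ₐ[K] CBar q M' n,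
      (∀ n a, Φ n (toCBar q M n a) = toCBar q M' n (φ n a)) ∧
      ∃ (j : ∀ n, CBar q M n →ₐ[K] CBar q M (n + 1))
        (j' : ∀ n, CBar q M' n →ₐ[K] CBar q M' (n + 1)),
        IsStandardInclusion q M j ∧ IsStandardInclusion q M' j' ∧
        ∀ n a, Φ (n + 1) (j n a) = j' n (Φ n a)

end QBrauer

end

noncomputable section

namespace QBrauer

/-! ### Relations of the algebra and induction on words -/

variable {K : Type u} [Field K]

/-! Put z = q - q⁻¹. Since T - T⁻¹ is unchanged under T ↦ -T⁻¹, this substitution fixes every E_i,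
and it carries the relations for r to those for r' = -r⁻¹ (`flipFree_rel`). The condition is kept in
the symmetric form r * r' = -1, so the inverse map is the same construction with r and r' exchanged,
and in (b), (c) it becomes an identity between powers of q.

The substitution exchanges the eigenvalues q and -q⁻¹ and matches r⁻¹ with r'⁻¹, while the
restriction rule is invariant under transposition; hence labels are transposed, by induction on n
(`HasLabel.flip`).

For the trace, the three-strand relations give Ĉ_{n+1} = Ĉ_n {1, T_n, E_n} Ĉ_n as a linear span
(`topSpan_eq_top`), so a Markov trace is unique. The pullback of a Markov trace along the
substitution is again one (`IsMarkovTrace.flip`), hence traces agree. Existence of the trace is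
never needed: it holds for both parameters or for neither, and then both functionals are 0 by
convention.

The same spanning set shows that an element of Ĉ_n lies in the annihilator on n strands exactly when
its image does on n + 1 strands, which gives the inclusions of the quotients. For (b) and (c) it
remains to check r * r' = q^m = -1, where q has order 2m, and x ≠ 0. -/

theorem T_mul_Tinv (r q : K) {n : ℕ} (i : Idx n) : T r q i * Tinv r q i = 1 := by
  simpa [T, Tinv] using proj_rel (Rel.mul_inv (r := r) (q := q) i)

theorem Tinv_mul_T (r q : K) {n : ℕ} (i : Idx n) : Tinv r q i * T r q i = 1 := by
  simpa [T, Tinv] using proj_rel (Rel.inv_mul (r := r) (q := q) i)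

theorem T_braid (r q : K) {n : ℕ} {i j : Idx n} (h : j.1 = i.1 + 1) :
    T r q i * T r q j * T r q i = T r q j * T r q i * T r q j := by
  simpa [T] using proj_rel (Rel.braid (r := r) (q := q) i j h)

theorem T_comm (r q : K) {n : ℕ} {i j : Idx n} (h : i.1 + 1 < j.1) :
    T r q i * T r q j = T r q j * T r q i := by
  simpa [T] using proj_rel (Rel.comm (r := r) (q := q) i j h)

theorem E_mul_T (r q : K) {n : ℕ} (i : Idx n) : E r q i * T r q i = r⁻¹ • E r q i := by
  simpa [T, E] using proj_rel (Rel.untwist (r := r) (q := q) i)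

theorem E_mul_T_mul_E (r q : K) {n : ℕ} {i j : Idx n} (h : i.1 = j.1 + 1) :
    E r q i * T r q j * E r q i = r • E r q i := by
  simpa [T, E] using proj_rel (Rel.curl_pos (r := r) (q := q) i j h)

theorem E_mul_Tinv_mul_E (r q : K) {n : ℕ} {i j : Idx n} (h : i.1 = j.1 + 1) :
    E r q i * Tinv r q j * E r q i = r⁻¹ • E r q i := by
  simpa [Tinv, E] using proj_rel (Rel.curl_neg (r := r) (q := q) i j h)

theorem E_eq (r q : K) {n : ℕ} (i : Idx n) :
    E r q i = 1 - (q - q⁻¹)⁻¹ • (T r q i - Tinv r q i) := by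
  simp [E, T, Tinv, freeE]

/-- `T_i` as a unit of `Ĉ_n(r,q)`. -/
def unitT (r q : K) {n : ℕ} (i : Idx n) : (CHat r q n)ˣ :=
  ⟨T r q i, Tinv r q i, T_mul_Tinv r q i, Tinv_mul_T r q i⟩

theorem Tinv_braid (r q : K) {n : ℕ} {i j : Idx n} (h : j.1 = i.1 + 1) :
    Tinv r q i * Tinv r q j * Tinv r q i = Tinv r q j * Tinv r q i * Tinv r q j := by
  have h1 : unitT r q i * unitT r q j * unitT r q i =
      unitT r q j * unitT r q i * unitT r q j := Units.ext (T_braid r q h)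
  have h2 := congrArg (fun w : (CHat r q n)ˣ => ((w⁻¹ : (CHat r q n)ˣ) : CHat r q n)) h1
  simp only [mul_inv_rev, Units.val_mul, ← mul_assoc] at h2
  exact h2

theorem Tinv_comm (r q : K) {n : ℕ} {i j : Idx n} (h : i.1 + 1 < j.1) :
    Tinv r q i * Tinv r q j = Tinv r q j * Tinv r q i := by
  have h1 : Commute (unitT r q i) (unitT r q j) := Units.ext (T_comm r q h)
  exact congrArg Units.val (h1.inv_inv).eq

theorem E_mul_Tinv {r : K} (hr : r ≠ 0) (q : K) {n : ℕ} (i : Idx n) :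
    E r q i * Tinv r q i = r • E r q i := by
  have h := congrArg (fun y => r • (y * Tinv r q i)) (E_mul_T r q i)
  simpa [mul_assoc, T_mul_Tinv, smul_smul, hr] using h.symm

theorem T_mul_E (r q : K) {n : ℕ} (i : Idx n) : T r q i * E r q i = r⁻¹ • E r q i := by
  rw [← E_mul_T, E_eq]
  simp [mul_sub, sub_mul, T_mul_Tinv, Tinv_mul_T]

/-- An induction principle for `Ĉ_n(r,q)`. -/
theorem CHat.induction {r q : K} {n : ℕ} {C : CHat r q n → Prop}
    (scalar : ∀ c : K, C (algebraMap K _ c)) (pos : ∀ i, C (T r q i))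
    (neg : ∀ i, C (Tinv r q i)) (mul : ∀ a b, C a → C b → C (a * b))
    (add : ∀ a b, C a → C b → C (a + b)) (a : CHat r q n) : C a := by
  obtain ⟨a, rfl⟩ : ∃ w, proj r q n w = a := RingQuot.mkAlgHom_surjective K _ a
  induction a using FreeAlgebra.induction with
  | grade0 c => simpa using scalar c
  | grade1 x =>
    cases x with
    | pos i => exact pos i
    | neg i => exact neg i
  | mul a b ha hb => simpa using mul _ _ ha hb
  | add a b ha hb => simpa using add _ _ ha hb

theorem CHat.algHom_ext {r q : K} {n : ℕ} {A : Type*} [Ring A] [Algebra K A]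
    {f g : CHat r q n →ₐ[K] A} (hT : ∀ i, f (T r q i) = g (T r q i))
    (hTinv : ∀ i, f (Tinv r q i) = g (Tinv r q i)) : f = g := by
  ext a
  induction a using CHat.induction with
  | scalar c => simp
  | pos i => exact hT i
  | neg i => exact hTinv i
  | mul a b ha hb => simp [ha, hb]
  | add a b ha hb => simp [ha, hb]

theorem incl_proj (r q : K) {n : ℕ} (a) : incl r q n (proj r q n a) = inclFree r q n a :=
  RingQuot.liftAlgHom_mkAlgHom_apply _ _ _ _

@[simp] theorem incl_T (r q : K) {n : ℕ} (i : Idx n) : incl r q n (T r q i) = T r q i.up := by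
  rw [T, incl_proj, inclFree_T]; rfl

@[simp] theorem incl_Tinv (r q : K) {n : ℕ} (i : Idx n) :
    incl r q n (Tinv r q i) = Tinv r q i.up := by
  rw [Tinv, incl_proj, inclFree_Tinv]; rfl

@[simp] theorem incl_E (r q : K) {n : ℕ} (i : Idx n) : incl r q n (E r q i) = E r q i.up := by
  rw [E, incl_proj, inclFree_E]; rfl

/-! ### The isomorphism `T_i ↦ -T_i⁻¹` -/

theorem ne_zero_of_mul_eq_neg_one {r r' : K} (h : r * r' = -1) : r ≠ 0 := by
  rintro rfl; simp at h

theorem inv_eq_neg_of_mul_eq_neg_one {r r' : K} (h : r * r' = -1) : r⁻¹ = -r' := by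
  exact inv_eq_of_mul_eq_one_right (by rw [mul_neg, h, neg_neg])

theorem mul_comm_eq_neg_one {r r' : K} (h : r * r' = -1) : r' * r = -1 := by rw [mul_comm, h]

/-- The homomorphism `T_i ↦ -T_i⁻¹`, `T_i⁻¹ ↦ -T_i` on the free algebra. -/
def flipFree (r' q : K) (n : ℕ) : FreeAlgebra K (Letter n) →ₐ[K] CHat r' q n :=
  FreeAlgebra.lift K fun
    | Letter.pos i => -Tinv r' q i
    | Letter.neg i => -T r' q i

theorem flipFree_T (r' q : K) {n : ℕ} (i : Idx n) :
    flipFree r' q n (freeT K i) = -Tinv r' q i := by simp [flipFree, freeT]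

theorem flipFree_Tinv (r' q : K) {n : ℕ} (i : Idx n) :
    flipFree r' q n (freeTinv K i) = -T r' q i := by simp [flipFree, freeTinv]

theorem flipFree_E (r' q : K) {n : ℕ} (i : Idx n) :
    flipFree r' q n (freeE q i) = E r' q i := by
  simp only [freeE, map_sub, map_one, map_smul, flipFree_T, flipFree_Tinv, E_eq]
  congr 2
  abel

/-- As E_i is fixed, untwisting becomes E_i T_i⁻¹ = r' E_i, because r⁻¹ = -r', and the two curl
relations are exchanged. The other relations are inverted, the signs cancelling. -/
theorem flipFree_rel {r r' : K} (h : r * r' = -1) (q : K) (n : ℕ)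
    ⦃a b : FreeAlgebra K (Letter n)⦄ (hab : Rel r q n a b) :
    flipFree r' q n a = flipFree r' q n b := by
  have hr' := ne_zero_of_mul_eq_neg_one (mul_comm_eq_neg_one h)
  have h1 := inv_eq_neg_of_mul_eq_neg_one h
  have h2 := inv_eq_neg_of_mul_eq_neg_one (mul_comm_eq_neg_one h)
  cases hab <;>
    simp only [map_mul, map_one, map_smul, flipFree_T, flipFree_Tinv, flipFree_E, neg_mul,
      mul_neg, neg_neg]
  · exact Tinv_mul_T r' q _
  · exact T_mul_Tinv r' q _
  · rw [Tinv_braid r' q ‹_›]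
  · rw [Tinv_comm r' q ‹_›]
  · rw [E_mul_Tinv hr', h1, neg_smul]
  · rw [E_mul_Tinv_mul_E r' q ‹_›, h2, neg_smul, neg_neg]
  · rw [E_mul_T_mul_E r' q ‹_›, h1, neg_smul]

/-- The homomorphism `Ĉ_n(r,q) → Ĉ_n(r',q)`, `T_i ↦ -T_i⁻¹`, where `r' = -r⁻¹`. -/
def flip {r r' : K} (h : r * r' = -1) (q : K) (n : ℕ) : CHat r q n →ₐ[K] CHat r' q n :=
  RingQuot.liftAlgHom K ⟨flipFree r' q n, flipFree_rel h q n⟩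

theorem flip_proj {r r' : K} (h : r * r' = -1) (q : K) {n : ℕ} (a) :
    flip h q n (proj r q n a) = flipFree r' q n a :=
  RingQuot.liftAlgHom_mkAlgHom_apply _ _ _ _

@[simp] theorem flip_T {r r' : K} (h : r * r' = -1) (q : K) {n : ℕ} (i : Idx n) :
    flip h q n (T r q i) = -Tinv r' q i := by rw [T, flip_proj, flipFree_T]

@[simp] theorem flip_Tinv {r r' : K} (h : r * r' = -1) (q : K) {n : ℕ} (i : Idx n) :
    flip h q n (Tinv r q i) = -T r' q i := by rw [Tinv, flip_proj, flipFree_Tinv]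

@[simp] theorem flip_E {r r' : K} (h : r * r' = -1) (q : K) {n : ℕ} (i : Idx n) :
    flip h q n (E r q i) = E r' q i := by rw [E, flip_proj, flipFree_E]

theorem flip_comp_flip {r r' : K} (h : r * r' = -1) (h' : r' * r = -1) (q : K) (n : ℕ) :
    (flip h' q n).comp (flip h q n) = AlgHom.id K _ :=
  CHat.algHom_ext (by simp) (by simp)

@[simp] theorem flip_flip {r r' : K} (h : r * r' = -1) (h' : r' * r = -1) (q : K) {n : ℕ}
    (a : CHat r q n) : flip h' q n (flip h q n a) = a :=
  DFunLike.congr_fun (flip_comp_flip h h' q n) a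

theorem flip_incl {r r' : K} (h : r * r' = -1) (q : K) {n : ℕ} (a : CHat r q n) :
    flip h q (n + 1) (incl r q n a) = incl r' q n (flip h q n a) :=
  DFunLike.congr_fun (f := (flip h q (n + 1)).comp (incl r q n))
    (g := (incl r' q n).comp (flip h q n)) (CHat.algHom_ext (by simp) (by simp)) a

/-- The isomorphism `Ĉ_n(r,q) ≅ Ĉ_n(r',q)`, `T_i ↦ -T_i⁻¹`, where `r' = -r⁻¹`. -/
def flipEquiv {r r' : K} (h : r * r' = -1) (q : K) (n : ℕ) : CHat r q n ≃ₐ[K] CHat r' q n :=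
  AlgEquiv.ofAlgHom (flip h q n) (flip (mul_comm_eq_neg_one h) q n)
    (flip_comp_flip _ _ q n) (flip_comp_flip _ _ q n)

@[simp] theorem flipEquiv_apply {r r' : K} (h : r * r' = -1) (q : K) (n : ℕ) (a : CHat r q n) :
    flipEquiv h q n a = flip h q n a := rfl

/-! ### Labels under transposition -/

theorem card_transpose (mu : YoungDiagram) : mu.transpose.card = mu.card := by
  simp [YoungDiagram.card, YoungDiagram.transpose]

theorem AddsBox.transpose {mu nu : YoungDiagram} (h : AddsBox mu nu) :
    AddsBox mu.transpose nu.transpose :=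
  ⟨YoungDiagram.transpose_mono h.1, by rw [card_transpose, card_transpose, h.2]⟩

theorem Restricts.transpose {n : ℕ} {lam mu : YoungDiagram} (h : Restricts n lam mu) :
    Restricts n lam.transpose mu.transpose :=
  h.imp AddsBox.transpose (And.imp (by rw [card_transpose]; exact id) AddsBox.transpose)

/-- Transposition of the labels that occur in a restriction. -/
def restrictsTranspose (n : ℕ) (lam : YoungDiagram) :
    {mu // Restricts n lam mu} ≃ {mu // Restricts n lam.transpose mu} where
  toFun mu := ⟨mu.1.transpose, mu.2.transpose⟩
  invFun mu := ⟨mu.1.transpose, by simpa using mu.2.transpose⟩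
  left_inv mu := by simp
  right_inv mu := by simp

theorem mem_rowTwo {c : ℕ × ℕ} : c ∈ rowTwo ↔ c.1 = 0 ∧ c.2 < 2 := by
  simp [rowTwo, YoungDiagram.mem_ofRowLens]

theorem mem_colTwo {c : ℕ × ℕ} : c ∈ colTwo ↔ c.1 < 2 ∧ c.2 = 0 := by
  obtain ⟨a, b⟩ := c
  rw [colTwo, YoungDiagram.mem_ofRowLens]
  constructor
  · rintro ⟨h, h'⟩
    simp only [List.length_cons, List.length_nil] at h
    interval_cases a <;> simp_all
  · rintro ⟨h, h'⟩
    simp only at h h'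
    interval_cases a <;> simp [h']

theorem rowTwo_transpose : rowTwo.transpose = colTwo := by
  ext c
  simp [mem_rowTwo, mem_colTwo, and_comm]

theorem colTwo_transpose : colTwo.transpose = rowTwo := by
  rw [← rowTwo_transpose, YoungDiagram.transpose_transpose]

theorem bot_transpose : (⊥ : YoungDiagram).transpose = ⊥ := by
  ext c
  simp

/-- Lets modules over the two different algebras be compared by semilinear equivalences. -/
instance flip_ringHomInvPair {r r' : K} (h : r * r' = -1) (q : K) (n : ℕ) :
    RingHomInvPair (flip h q n).toRingHom (flip (mul_comm_eq_neg_one h) q n).toRingHom where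
  comp_eq := RingHom.ext fun a => flip_flip h _ q a
  comp_eq₂ := RingHom.ext fun a => flip_flip _ h q a

theorem Tinv_smul_of_T_smul {r q : K} {n : ℕ} {M : Type*} [AddCommGroup M]
    [Module (CHat r q n) M] {i : Idx n} {c : K} (hc : c ≠ 0) {v : M}
    (hv : T r q i • v = algebraMap K (CHat r q n) c • v) :
    Tinv r q i • v = algebraMap K (CHat r q n) c⁻¹ • v := by
  have h := congrArg (fun w => algebraMap K (CHat r q n) c⁻¹ • Tinv r q i • w) hv
  rw [smul_smul (Tinv r q i) (T r q i), Tinv_mul_T, one_smul, smul_smul (Tinv r q i),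
    ← Algebra.commutes, ← smul_smul, smul_smul _ _ (Tinv r q i • v), ← map_mul,
    inv_mul_cancel₀ hc, map_one, one_smul] at h
  exact h.symm

/-- A semilinear equivalence identifies submodule lattices, so it preserves simplicity and direct
sum decompositions; restriction is compatible with it by `flip_incl`. Both modules are arbitrary so
that the induction hypothesis applies to the summands of the restriction. -/
theorem HasLabel.flip {q : K} (hq : q ≠ 0) (n : ℕ) :
    ∀ {r r' : K} (h : r * r' = -1) (lam : YoungDiagram) (M M' : Type u)
      [AddCommGroup M] [AddCommGroup M'] [Module (CHat r q n) M] [Module (CHat r' q n) M']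
      (_ : M ≃ₛₗ[(QBrauer.flip h q n).toRingHom] M'),
      HasLabel r q n lam M → HasLabel r' q n lam.transpose M' := by
  induction n with
  | zero =>
    intro r r' h lam M M' _ _ _ _ e
    rw [HasLabel, HasLabel]
    rintro ⟨hM, rfl⟩
    exact ⟨(isSimpleModule_iff _ _).2 ((Submodule.orderIsoMapComap e).isSimpleOrder_iff.1
      ((isSimpleModule_iff _ _).1 hM)), bot_transpose⟩
  | succ n ih =>
    intro r r' h lam M M' _ _ _ _ e
    rw [HasLabel, HasLabel]
    rintro ⟨hM, hk, h2, N, hN, hN', hl⟩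
    refine ⟨(isSimpleModule_iff _ _).2 ((Submodule.orderIsoMapComap e).isSimpleOrder_iff.1
      ((isSimpleModule_iff _ _).1 hM)), by simpa only [card_transpose] using hk, ?_, ?_⟩
    · intro hn i v
      obtain ⟨v, rfl⟩ := e.surjective v
      -- The inverse of T_i corresponds to -T_i on the other side, so an eigenvalue c turns into
      -- -c⁻¹.
      have key : ∀ c : K, c ≠ 0 → T r q i • v = algebraMap K (CHat r q (n + 1)) c • v →
          T r' q i • e v = algebraMap K (CHat r' q (n + 1)) (-c⁻¹) • e v := by
        intro c hc hv
        have h3 := congrArg e (Tinv_smul_of_T_smul hc hv)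
        rw [e.map_smulₛₗ, e.map_smulₛₗ] at h3
        have h4 : (QBrauer.flip h q (n + 1)).toRingHom (Tinv r q i) = -T r' q i := flip_Tinv h q i
        have h5 : (QBrauer.flip h q (n + 1)).toRingHom (algebraMap K _ c⁻¹) =
          algebraMap K _ c⁻¹ := (QBrauer.flip h q (n + 1)).commutes _
        rw [h4, h5, neg_smul] at h3
        rw [map_neg, neg_smul, ← h3, neg_neg]
      obtain ⟨a, b, c⟩ := h2 hn i v
      refine ⟨fun hl => ?_, fun hl => ?_, fun hl => ?_⟩
      · rw [YoungDiagram.transpose_eq_iff_eq_transpose, rowTwo_transpose] at hl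
        have := key _ (neg_ne_zero.2 (inv_ne_zero hq)) (b hl)
        simpa only [inv_neg, inv_inv, neg_neg] using this
      · rw [YoungDiagram.transpose_eq_iff_eq_transpose, colTwo_transpose] at hl
        exact key _ hq (a hl)
      · rw [YoungDiagram.transpose_eq_iff_eq_transpose, bot_transpose] at hl
        have := key _ (inv_ne_zero (ne_zero_of_mul_eq_neg_one h)) (c hl)
        rwa [inv_inv, ← inv_eq_neg_of_mul_eq_neg_one (mul_comm_eq_neg_one h)] at this
    · let : Module (CHat r q n) M := Module.compHom M (incl r q n).toRingHom
      let : Module (CHat r' q n) M' := Module.compHom M' (incl r' q n).toRingHom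
      -- The same additive map, now semilinear over the algebras on n strands.
      let e' : M ≃ₛₗ[(QBrauer.flip h q n).toRingHom] M' :=
        { e with
          map_smul' := fun a v => by
            change e (incl r q n a • v) = incl r' q n (QBrauer.flip h q n a) • e v
            rw [e.map_smulₛₗ, ← flip_incl]
            rfl }
      let g := Submodule.orderIsoMapComap e'
      refine ⟨fun mu => g (N ((restrictsTranspose (n + 1) lam).symm mu)), ?_, ?_, ?_⟩
      · exact ((iSupIndep_map_orderIso_iff g).2 hN).comp
          (restrictsTranspose (n + 1) lam).symm.injective
      · rw [← g.map_iSup, (restrictsTranspose (n + 1) lam).symm.surjective.iSup_comp N, hN',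
          g.map_top]
      · intro mu
        have h3 := ih h _ (N ((restrictsTranspose (n + 1) lam).symm mu))
          (g (N ((restrictsTranspose (n + 1) lam).symm mu))) (e'.submoduleMap _) (hl _)
        have h4 : ((restrictsTranspose (n + 1) lam).symm mu).1.transpose = mu.1 :=
          congrArg Subtype.val ((restrictsTranspose (n + 1) lam).apply_symm_apply mu)
        rwa [h4] at h3

/-- `flip` as a semilinear map of regular modules. -/
def flipSemilinear {r r' : K} (h : r * r' = -1) (q : K) (n : ℕ) :
    CHat r q n ≃ₛₗ[(flip h q n).toRingHom] CHat r' q n where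
  toFun := flip h q n
  invFun := flip (mul_comm_eq_neg_one h) q n
  left_inv := flip_flip h _ q
  right_inv := flip_flip _ h q
  map_add' := map_add _
  map_smul' a b := map_mul (flip h q n) a b

theorem map_component_le {r r' q : K} (h : r * r' = -1) (hq : q ≠ 0) (n : ℕ)
    (lam : YoungDiagram) :
    Submodule.map (flipSemilinear h q n).toLinearMap (component r q n lam) ≤
      component r' q n lam.transpose := by
  rw [component, sSup_eq_iSup', Submodule.map_iSup]
  exact iSup_le fun L => le_sSup
    (HasLabel.flip hq n h lam _ _ ((flipSemilinear h q n).submoduleMap L.1) L.2)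

theorem flip_mem_component {r r' q : K} (h : r * r' = -1) (hq : q ≠ 0) {n : ℕ}
    {lam : YoungDiagram} {a : CHat r q n} (ha : a ∈ component r q n lam) :
    flip h q n a ∈ component r' q n lam.transpose :=
  map_component_le h hq n lam (Submodule.mem_map_of_mem ha)

theorem flipEquiv_image_component {r r' q : K} (h : r * r' = -1) (hq : q ≠ 0) (n : ℕ)
    (lam : YoungDiagram) :
    flipEquiv h q n '' (component r q n lam : Set (CHat r q n)) =
      (component r' q n lam.transpose : Set (CHat r' q n)) := by
  refine Set.Subset.antisymm ?_ fun b hb => ⟨flip (mul_comm_eq_neg_one h) q n b, ?_, ?_⟩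
  · rintro _ ⟨a, ha, rfl⟩
    exact flip_mem_component h hq ha
  · simpa using flip_mem_component (mul_comm_eq_neg_one h) hq hb
  · exact flip_flip _ _ q b

/-! ### Relations on three strands -/

section ThreeStrands

variable {r q : K} {n : ℕ}

theorem Tinv_eq (hz : q - q⁻¹ ≠ 0) (i : Idx n) :
    Tinv r q i = T r q i - (q - q⁻¹) • (1 - E r q i) := by
  rw [E_eq, sub_sub_cancel, smul_smul, mul_inv_cancel₀ hz, one_smul, sub_sub_cancel]

theorem T_mul_T (hz : q - q⁻¹ ≠ 0) (i : Idx n) :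
    T r q i * T r q i = 1 + (q - q⁻¹) • (T r q i - r⁻¹ • E r q i) := by
  have h := T_mul_Tinv r q i
  rw [Tinv_eq hz, mul_sub, mul_smul_comm, mul_sub, mul_one, T_mul_E] at h
  rw [← h, sub_add_cancel]

theorem E_mul_E (hr : r ≠ 0) (i : Idx n) : E r q i * E r q i = xParam r q • E r q i := by
  nth_rewrite 2 [E_eq r q i]
  rw [mul_sub, mul_smul_comm, mul_sub, E_mul_T, E_mul_Tinv hr, mul_one, xParam]
  module

/-- Expanding the middle E_j gives x - (r - r⁻¹)/z = 1 as coefficient. The curl relations are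
hypotheses so that both orders of neighbours are covered. -/
theorem E_mul_E_mul_E (hr : r ≠ 0) {i j : Idx n}
    (hp : E r q i * T r q j * E r q i = r • E r q i)
    (hm : E r q i * Tinv r q j * E r q i = r⁻¹ • E r q i) :
    E r q i * E r q j * E r q i = E r q i := by
  rw [E_eq r q j, mul_sub, sub_mul, mul_smul_comm, smul_mul_assoc, mul_sub, sub_mul, hp, hm,
    mul_one, E_mul_E hr, xParam]
  module

/-- E_i is a linear combination of 1, T_i and T_i⁻¹, so whatever intertwines the T's intertwines the
E's. -/
theorem mul_E_of_mul_T {w : CHat r q n} {i j : Idx n} (h : w * T r q i = T r q j * w) :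
    w * E r q i = E r q j * w := by
  have h' : w * Tinv r q i = Tinv r q j * w := by
    have h1 := congrArg (fun y => Tinv r q j * y * Tinv r q i) h
    simp only [mul_assoc, T_mul_Tinv, mul_one] at h1
    rw [← mul_assoc (Tinv r q j) (T r q j), Tinv_mul_T, one_mul] at h1
    exact h1.symm
  rw [E_eq, E_eq, mul_sub, sub_mul, mul_smul_comm, smul_mul_assoc, mul_sub, sub_mul, h, h',
    one_mul, mul_one]


theorem T_mul_T_mul_E {i j : Idx n} (h : j.1 = i.1 + 1) :
    T r q i * T r q j * E r q i = E r q j * (T r q i * T r q j) :=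
  mul_E_of_mul_T (by rw [T_braid r q h, mul_assoc])

theorem T_mul_T_mul_E' {i j : Idx n} (h : j.1 = i.1 + 1) :
    T r q j * T r q i * E r q j = E r q i * (T r q j * T r q i) :=
  mul_E_of_mul_T (by rw [← T_braid r q h, mul_assoc])

theorem Tinv_mul_Tinv_mul_E {i j : Idx n} (h : j.1 = i.1 + 1) :
    Tinv r q i * Tinv r q j * E r q i = E r q j * (Tinv r q i * Tinv r q j) := by
  have h1 := T_mul_T_mul_E' (r := r) (q := q) h
  let w : (CHat r q n)ˣ := unitT r q j * unitT r q i
  change ((w⁻¹ : (CHat r q n)ˣ) : CHat r q n) * _ = _ * ((w⁻¹ : (CHat r q n)ˣ) : CHat r q n)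
  change (w : CHat r q n) * _ = _ * (w : CHat r q n) at h1
  rw [Units.eq_mul_inv_iff_mul_eq, mul_assoc, ← h1, Units.inv_mul_cancel_left]

theorem half_twist_mul_E {i j : Idx n} (h : j.1 = i.1 + 1) :
    T r q i * T r q j * T r q i * E r q i = E r q j * (T r q i * T r q j * T r q i) :=
  mul_E_of_mul_T (by
    nth_rewrite 1 [T_braid r q h]
    simp only [mul_assoc])

/-- Conjugation by the half twist T_i T_j T_i swaps i and j. It transports the curl relations,
imposed only for a lower neighbour between two E's, to the upper neighbour. -/
theorem E_mul_half_twist_conj {i j : Idx n} (h : j.1 = i.1 + 1) {a b : CHat r q n} {c : K}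
    (hab : T r q i * T r q j * T r q i * b = a * (T r q i * T r q j * T r q i))
    (ha : E r q j * a * E r q j = c • E r q j) : E r q i * b * E r q i = c • E r q i := by
  have h1 := half_twist_mul_E (r := r) (q := q) h
  let w : (CHat r q n)ˣ := unitT r q i * unitT r q j * unitT r q i
  change (w : CHat r q n) * _ = _ * (w : CHat r q n) at h1 hab
  rw [← Units.mul_right_inj w, ← mul_assoc, ← mul_assoc, h1, mul_assoc (E r q j), hab,
    mul_assoc, mul_assoc, h1, mul_smul_comm, h1, ← smul_mul_assoc, ← ha]
  simp only [mul_assoc]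

theorem half_twist_mul_T {i j : Idx n} (h : j.1 = i.1 + 1) :
    T r q i * T r q j * T r q i * T r q j = T r q i * (T r q i * T r q j * T r q i) := by
  rw [T_braid r q h]
  simp only [← mul_assoc]
  rw [T_braid r q h]

theorem half_twist_mul_Tinv {i j : Idx n} (h : j.1 = i.1 + 1) :
    T r q i * T r q j * T r q i * Tinv r q j = Tinv r q i * (T r q i * T r q j * T r q i) := by
  have h1 := half_twist_mul_T (r := r) (q := q) h
  let w : (CHat r q n)ˣ := unitT r q i * unitT r q j * unitT r q i
  change (w : CHat r q n) * ((unitT r q j : (CHat r q n)ˣ) : CHat r q n) =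
    ((unitT r q i : (CHat r q n)ˣ) : CHat r q n) * (w : CHat r q n) at h1
  change (w : CHat r q n) * (((unitT r q j)⁻¹ : (CHat r q n)ˣ) : CHat r q n) =
    (((unitT r q i)⁻¹ : (CHat r q n)ˣ) : CHat r q n) * (w : CHat r q n)
  rw [Units.mul_inv_eq_iff_eq_mul, mul_assoc, h1, Units.inv_mul_cancel_left]

theorem E_mul_T_mul_E' {i j : Idx n} (h : j.1 = i.1 + 1) :
    E r q i * T r q j * E r q i = r • E r q i :=
  E_mul_half_twist_conj h (half_twist_mul_T h) (E_mul_T_mul_E r q h)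

theorem E_mul_Tinv_mul_E' {i j : Idx n} (h : j.1 = i.1 + 1) :
    E r q i * Tinv r q j * E r q i = r⁻¹ • E r q i :=
  E_mul_half_twist_conj h (half_twist_mul_Tinv h) (E_mul_Tinv_mul_E r q h)

theorem E_succ_mul_E_mul_E (hr : r ≠ 0) {i j : Idx n} (h : j.1 = i.1 + 1) :
    E r q j * E r q i * E r q j = E r q j :=
  E_mul_E_mul_E hr (E_mul_T_mul_E r q h) (E_mul_Tinv_mul_E r q h)

theorem E_mul_E_succ_mul_E (hr : r ≠ 0) {i j : Idx n} (h : j.1 = i.1 + 1) :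
    E r q i * E r q j * E r q i = E r q i :=
  E_mul_E_mul_E hr (E_mul_T_mul_E' h) (E_mul_Tinv_mul_E' h)

theorem Tinv_mul_E (hr : r ≠ 0) (i : Idx n) : Tinv r q i * E r q i = r • E r q i := by
  have h := congrArg (fun y => r • (Tinv r q i * y)) (T_mul_E r q i)
  simpa [← mul_assoc, Tinv_mul_T, smul_smul, hr] using h.symm

/-- Slide E through T_i T_j, insert E_i = E_i E_j E_i, slide back, and the left part collapses to
E_j. -/
theorem E_mul_T_mul_T (hr : r ≠ 0) {i j : Idx n} (h : j.1 = i.1 + 1) :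
    E r q j * T r q i * T r q j = E r q j * E r q i := by
  have h1 : E r q j * T r q i * T r q j * E r q j = E r q j := by
    rw [mul_assoc, T_mul_E, mul_smul_comm, E_mul_T_mul_E r q h, smul_smul, inv_mul_cancel₀ hr,
      one_smul]
  calc E r q j * T r q i * T r q j = T r q i * T r q j * E r q i := by
        rw [T_mul_T_mul_E h, mul_assoc]
    _ = T r q i * T r q j * (E r q i * E r q j * E r q i) := by rw [E_mul_E_succ_mul_E hr h]
    _ = T r q i * T r q j * E r q i * E r q j * E r q i := by simp only [mul_assoc]
    _ = E r q j * T r q i * T r q j * E r q j * E r q i := by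
        rw [T_mul_T_mul_E h]; simp only [mul_assoc]
    _ = E r q j * E r q i := by rw [h1]

theorem E_mul_Tinv_mul_Tinv (hr : r ≠ 0) {i j : Idx n} (h : j.1 = i.1 + 1) :
    E r q j * Tinv r q i * Tinv r q j = E r q j * E r q i := by
  have h1 : E r q j * Tinv r q i * Tinv r q j * E r q j = E r q j := by
    rw [mul_assoc, Tinv_mul_E hr, mul_smul_comm, E_mul_Tinv_mul_E r q h, smul_smul,
      mul_inv_cancel₀ hr, one_smul]
  calc E r q j * Tinv r q i * Tinv r q j = Tinv r q i * Tinv r q j * E r q i := by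
        rw [Tinv_mul_Tinv_mul_E h, mul_assoc]
    _ = Tinv r q i * Tinv r q j * (E r q i * E r q j * E r q i) := by
        rw [E_mul_E_succ_mul_E hr h]
    _ = Tinv r q i * Tinv r q j * E r q i * E r q j * E r q i := by simp only [mul_assoc]
    _ = E r q j * Tinv r q i * Tinv r q j * E r q j * E r q i := by
        rw [Tinv_mul_Tinv_mul_E h]; simp only [mul_assoc]
    _ = E r q j * E r q i := by rw [h1]

theorem T_mul_T_mul_E_succ (hr : r ≠ 0) {i j : Idx n} (h : j.1 = i.1 + 1) :
    T r q j * T r q i * E r q j = E r q i * E r q j := by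
  have h1 : E r q j * (T r q j * T r q i * E r q j) = E r q j := by
    rw [← mul_assoc, ← mul_assoc, E_mul_T, smul_mul_assoc, smul_mul_assoc,
      E_mul_T_mul_E r q h, smul_smul, inv_mul_cancel₀ hr, one_smul]
  calc T r q j * T r q i * E r q j = E r q i * (T r q j * T r q i) := T_mul_T_mul_E' h
    _ = E r q i * E r q j * E r q i * (T r q j * T r q i) := by rw [E_mul_E_succ_mul_E hr h]
    _ = E r q i * (E r q j * (T r q j * T r q i * E r q j)) := by
        rw [T_mul_T_mul_E' h]; simp only [mul_assoc]
    _ = E r q i * E r q j := by rw [h1]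

/-- Multiply T_i T_j E_i = E_j E_i by T_i⁻¹. This trades a leading T_j for E_j at the cost of a
factor on fewer strands. -/
theorem T_mul_E_pred (hr : r ≠ 0) {i j : Idx n} (h : j.1 = i.1 + 1) :
    T r q j * E r q i = Tinv r q i * E r q j * E r q i := by
  rw [mul_assoc, ← E_mul_T_mul_T hr h, mul_assoc (E r q j), ← T_mul_T_mul_E h, ← mul_assoc,
    ← mul_assoc, Tinv_mul_T, one_mul]

theorem E_mul_E_mul_T (hr : r ≠ 0) {i j : Idx n} (h : j.1 = i.1 + 1) :
    E r q j * E r q i * T r q j = E r q j * Tinv r q i := by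
  rw [← E_mul_Tinv_mul_Tinv hr h, mul_assoc, Tinv_mul_T, mul_one]

end ThreeStrands

/-! ### The spanning set `Ĉ_n {1, T_n, E_n} Ĉ_n` of `Ĉ_{n+1}` -/

/-- The elements `1`, `T_n`, `E_n` of `Ĉ_{n+1}(r,q)`. -/
def IsTop (r q : K) (n : ℕ) (x : CHat r q (n + 1)) : Prop :=
  x = 1 ∨ ∃ i : Idx (n + 1), i.1 = n ∧ (x = T r q i ∨ x = E r q i)

/-- The span of `Ĉ_n {1, T_n, E_n} Ĉ_n`. -/
def topSpan (r q : K) (n : ℕ) : Submodule K (CHat r q (n + 1)) :=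
  Submodule.span K {y | ∃ a x b, IsTop r q n x ∧ y = incl r q n a * x * incl r q n b}

variable {r q : K}

theorem mem_topSpan {n : ℕ} {x : CHat r q (n + 1)} (hx : IsTop r q n x) (a b : CHat r q n) :
    incl r q n a * x * incl r q n b ∈ topSpan r q n :=
  Submodule.subset_span ⟨a, x, b, hx, rfl⟩

theorem incl_mul_mem_topSpan {n : ℕ} (a : CHat r q n) {y : CHat r q (n + 1)}
    (hy : y ∈ topSpan r q n) : incl r q n a * y ∈ topSpan r q n := by
  induction hy using Submodule.span_induction with
  | mem y hy =>
    obtain ⟨b, x, c, hx, rfl⟩ := hy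
    simpa only [map_mul, mul_assoc] using mem_topSpan hx (a * b) c
  | zero => simp
  | add y z _ _ hy hz => rw [mul_add]; exact add_mem hy hz
  | smul c y _ hy => rw [mul_smul_comm]; exact Submodule.smul_mem _ c hy

theorem mul_incl_mem_topSpan {n : ℕ} (a : CHat r q n) {y : CHat r q (n + 1)}
    (hy : y ∈ topSpan r q n) : y * incl r q n a ∈ topSpan r q n := by
  induction hy using Submodule.span_induction with
  | mem y hy =>
    obtain ⟨b, x, c, hx, rfl⟩ := hy
    simpa only [map_mul, mul_assoc] using mem_topSpan hx b (c * a)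
  | zero => simp
  | add y z _ _ hy hz => rw [add_mul]; exact add_mem hy hz
  | smul c y _ hy => rw [smul_mul_assoc]; exact Submodule.smul_mem _ c hy

theorem IsTop.mem_topSpan {n : ℕ} {x : CHat r q (n + 1)} (hx : IsTop r q n x) :
    x ∈ topSpan r q n := by
  simpa using QBrauer.mem_topSpan hx 1 1

theorem isTop_one {n : ℕ} : IsTop r q n 1 := Or.inl rfl

theorem isTop_T {n : ℕ} {i : Idx (n + 1)} (hi : i.1 = n) : IsTop r q n (T r q i) :=
  Or.inr ⟨i, hi, Or.inl rfl⟩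

theorem isTop_E {n : ℕ} {i : Idx (n + 1)} (hi : i.1 = n) : IsTop r q n (E r q i) :=
  Or.inr ⟨i, hi, Or.inr rfl⟩

/-- The words `χ Y X` with `χ ∈ {T_n, E_n}`, `Y ∈ {1, T_{n-1}, E_{n-1}}`, `X ∈ {1, T_n, E_n}`. -/
theorem mul_mul_mem_topSpan (hr : r ≠ 0) (hz : q - q⁻¹ ≠ 0) {n : ℕ} {j : Idx (n + 2)}
    (hj : j.1 = n + 1) {y : CHat r q (n + 1)} (hy : IsTop r q n y) {x : CHat r q (n + 2)}
    (hx : IsTop r q (n + 1) x) :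
    T r q j * (incl r q (n + 1) y * x) ∈ topSpan r q (n + 1) ∧
      E r q j * (incl r q (n + 1) y * x) ∈ topSpan r q (n + 1) := by
  have h1 : (1 : CHat r q (n + 2)) ∈ topSpan r q (n + 1) := isTop_one.mem_topSpan
  have hT : T r q j ∈ topSpan r q (n + 1) := (isTop_T hj).mem_topSpan
  have hE : E r q j ∈ topSpan r q (n + 1) := (isTop_E hj).mem_topSpan
  have hx' : x = 1 ∨ x = T r q j ∨ x = E r q j := by
    refine hx.imp_right ?_
    rintro ⟨k, hk, h⟩
    obtain rfl : k = j := Subtype.ext (hk.trans hj.symm)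
    exact h
  rcases hy with rfl | ⟨i, hi, rfl | rfl⟩
  · rw [map_one, one_mul]
    rcases hx' with rfl | rfl | rfl
    · rw [mul_one, mul_one]
      exact ⟨hT, hE⟩
    · rw [T_mul_T hz, E_mul_T]
      exact ⟨add_mem h1 (Submodule.smul_mem _ _ (sub_mem hT (Submodule.smul_mem _ _ hE))),
        Submodule.smul_mem _ _ hE⟩
    · rw [T_mul_E, E_mul_E hr]
      exact ⟨Submodule.smul_mem _ _ hE, Submodule.smul_mem _ _ hE⟩
  all_goals
    have h : j.1 = i.up.1 + 1 := hj.trans (congrArg (· + 1) hi.symm)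
    simp only [incl_T, incl_E, ← mul_assoc]
  · rcases hx' with rfl | rfl | rfl
    · rw [mul_one, mul_one, ← incl_T]
      exact ⟨mul_incl_mem_topSpan _ hT, mul_incl_mem_topSpan _ hE⟩
    · rw [← T_braid r q h, E_mul_T_mul_T hr h, ← incl_T, ← incl_E]
      exact ⟨mem_topSpan (isTop_T hj) _ _, mul_incl_mem_topSpan _ hE⟩
    · rw [T_mul_T_mul_E_succ hr h, E_mul_T_mul_E r q h, ← incl_E]
      exact ⟨incl_mul_mem_topSpan _ hE, Submodule.smul_mem _ _ hE⟩
  -- For Y = E_{n-1}, a leading T_n is first turned into E_n by `T_mul_E_pred`.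
  · rcases hx' with rfl | rfl | rfl
    · rw [mul_one, mul_one, T_mul_E_pred hr h, ← incl_Tinv, ← incl_E]
      exact ⟨mem_topSpan (isTop_E hj) _ _, mul_incl_mem_topSpan _ hE⟩
    · rw [T_mul_E_pred hr h, mul_assoc, mul_assoc, ← mul_assoc (E r q j), E_mul_E_mul_T hr h,
        ← mul_assoc, ← incl_Tinv]
      exact ⟨mem_topSpan (isTop_E hj) _ _, mul_incl_mem_topSpan _ hE⟩
    · rw [T_mul_E_pred hr h, mul_assoc, mul_assoc, ← mul_assoc (E r q j),
        E_succ_mul_E_mul_E hr h, ← incl_Tinv]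
      exact ⟨incl_mul_mem_topSpan _ hE, hE⟩

theorem T_commute_incl_incl {n : ℕ} {j : Idx (n + 2)} (hj : j.1 = n + 1) (a : CHat r q n) :
    Commute (T r q j) (incl r q (n + 1) (incl r q n a)) := by
  have hT (i : Idx n) : Commute (T r q j) (T r q i.up.up) :=
    (T_comm r q (by rw [hj]; exact Nat.succ_lt_succ i.2.2)).symm
  induction a using CHat.induction with
  | scalar c =>
    rw [AlgHom.commutes, AlgHom.commutes]
    exact (Algebra.commutes c (T r q j)).symm
  | pos i => simpa using hT i
  | neg i =>
    have h : Commute (unitT r q j) (unitT r q i.up.up) := Units.ext (hT i)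
    rw [incl_Tinv, incl_Tinv]
    exact congrArg Units.val h.inv_right.eq
  | mul a b ha hb => simpa using ha.mul_right hb
  | add a b ha hb => simpa using ha.add_right hb

theorem commute_E_of_commute_T {n : ℕ} {j : Idx n} {a : CHat r q n}
    (h : Commute (T r q j) a) : Commute (E r q j) a :=
  (mul_E_of_mul_T h.eq.symm).symm

theorem IsTop.commute_incl_incl {n : ℕ} {x : CHat r q (n + 2)} (hx : IsTop r q (n + 1) x)
    (a : CHat r q n) : Commute x (incl r q (n + 1) (incl r q n a)) := by
  rcases hx with rfl | ⟨j, hj, rfl | rfl⟩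
  · exact Commute.one_left _
  · exact T_commute_incl_incl hj a
  · exact commute_E_of_commute_T (T_commute_incl_incl hj a)

theorem eq_algebraMap_of_le_one {n : ℕ} (hn : n ≤ 1) (a : CHat r q n) :
    ∃ c : K, a = algebraMap K _ c := by
  induction a using CHat.induction with
  | scalar c => exact ⟨c, rfl⟩
  | pos i => have := i.2; omega
  | neg i => have := i.2; omega
  | mul a b ha hb =>
    obtain ⟨c, rfl⟩ := ha
    obtain ⟨d, rfl⟩ := hb
    exact ⟨c * d, (map_mul _ _ _).symm⟩
  | add a b ha hb =>
    obtain ⟨c, rfl⟩ := ha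
    obtain ⟨d, rfl⟩ := hb
    exact ⟨c + d, (map_add _ _ _).symm⟩

/-- The span contains 1, so closure under left multiplication by generators suffices. Only the top
generator needs work: expanding the left factor by the induction hypothesis leaves words χ Y X,
treated in `mul_mul_mem_topSpan`. -/
theorem topSpan_eq_top (hr : r ≠ 0) (hz : q - q⁻¹ ≠ 0) (n : ℕ) : topSpan r q n = ⊤ := by
  induction n with
  | zero =>
    refine eq_top_iff.2 fun a _ => ?_
    obtain ⟨c, rfl⟩ := eq_algebraMap_of_le_one le_rfl a
    rw [Algebra.algebraMap_eq_smul_one]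
    exact Submodule.smul_mem _ _ isTop_one.mem_topSpan
  | succ n ih =>
    have top {j : Idx (n + 2)} (hj : j.1 = n + 1) {w : CHat r q (n + 2)}
        (hw : w ∈ topSpan r q (n + 1)) :
        T r q j * w ∈ topSpan r q (n + 1) ∧ E r q j * w ∈ topSpan r q (n + 1) := by
      induction hw using Submodule.span_induction with
      | zero => simp
      | add y z _ _ hy hz =>
        rw [mul_add, mul_add]
        exact ⟨add_mem hy.1 hz.1, add_mem hy.2 hz.2⟩
      | smul c y _ hy =>
        rw [mul_smul_comm, mul_smul_comm]
        exact ⟨Submodule.smul_mem _ _ hy.1, Submodule.smul_mem _ _ hy.2⟩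
      | mem w hw =>
        obtain ⟨a, x, b, hx, rfl⟩ := hw
        have ha : a ∈ topSpan r q n := ih ▸ Submodule.mem_top
        simp only [← mul_assoc]
        refine And.imp (mul_incl_mem_topSpan b) (mul_incl_mem_topSpan b) ?_
        induction ha using Submodule.span_induction with
        | zero => simp
        | add y z _ _ hy hz =>
          simp only [map_add, mul_add, add_mul]
          exact ⟨add_mem hy.1 hz.1, add_mem hy.2 hz.2⟩
        | smul c y _ hy =>
          simp only [map_smul, mul_smul_comm, smul_mul_assoc]
          exact ⟨Submodule.smul_mem _ _ hy.1, Submodule.smul_mem _ _ hy.2⟩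
        | mem w hw =>
          obtain ⟨a₁, y, a₂, hy, rfl⟩ := hw
          have h3 := mul_mul_mem_topSpan hr hz hj hy hx
          -- The outer factors come from two strands fewer, so they commute with u and x and can be
          -- moved to the two ends.
          have key (u : CHat r q (n + 2)) (hu : Commute u (incl r q (n + 1) (incl r q n a₁))) :
              u * incl r q (n + 1) (incl r q n a₁ * y * incl r q n a₂) * x =
                incl r q (n + 1) (incl r q n a₁) * (u * (incl r q (n + 1) y * x)) *
                  incl r q (n + 1) (incl r q n a₂) := by
            simp only [map_mul, mul_assoc]
            rw [← (hx.commute_incl_incl a₂).eq, ← mul_assoc, hu.eq]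
            simp only [mul_assoc]
          rw [key _ ((isTop_T hj).commute_incl_incl a₁),
            key _ ((isTop_E hj).commute_incl_incl a₁)]
          exact ⟨mul_incl_mem_topSpan _ (incl_mul_mem_topSpan _ h3.1),
            mul_incl_mem_topSpan _ (incl_mul_mem_topSpan _ h3.2)⟩
    have main (a : CHat r q (n + 2)) : ∀ w ∈ topSpan r q (n + 1), a * w ∈ topSpan r q (n + 1) := by
      have below {i : Idx (n + 2)} (hi : i.1 ≠ n + 1) : ∃ k : Idx (n + 1), i = k.up :=
        ⟨⟨i.1, i.2.1, by have := i.2.2; omega⟩, rfl⟩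
      induction a using CHat.induction with
      | scalar c =>
        intro w hw
        rw [← Algebra.smul_def]
        exact Submodule.smul_mem _ _ hw
      | pos i =>
        intro w hw
        by_cases hi : i.1 = n + 1
        · exact (top hi hw).1
        · obtain ⟨k, rfl⟩ := below hi
          rw [← incl_T]
          exact incl_mul_mem_topSpan _ hw
      | neg i =>
        intro w hw
        by_cases hi : i.1 = n + 1
        · rw [Tinv_eq hz, sub_mul, smul_mul_assoc, sub_mul, one_mul]
          exact sub_mem (top hi hw).1 (Submodule.smul_mem _ _ (sub_mem hw (top hi hw).2))
        · obtain ⟨k, rfl⟩ := below hi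
          rw [← incl_Tinv]
          exact incl_mul_mem_topSpan _ hw
      | mul a b ha hb =>
        intro w hw
        rw [mul_assoc]
        exact ha _ (hb _ hw)
      | add a b ha hb =>
        intro w hw
        rw [add_mul]
        exact add_mem (ha _ hw) (hb _ hw)
    exact eq_top_iff.2 fun a _ => by simpa using main a 1 isTop_one.mem_topSpan

/-! ### The Markov trace -/

theorem sub_inv_ne_zero {q : K} (hq : q ≠ 0) (hq2 : q ^ 2 ≠ 1) : q - q⁻¹ ≠ 0 := by
  intro h
  apply hq2
  rw [sq]
  nth_rewrite 2 [sub_eq_zero.1 h]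
  exact mul_inv_cancel₀ hq

theorem xParam_flip {r r' : K} (h : r * r' = -1) (q : K) : xParam r' q = xParam r q := by
  rw [xParam, xParam, inv_eq_neg_of_mul_eq_neg_one h,
    inv_eq_neg_of_mul_eq_neg_one (mul_comm_eq_neg_one h)]
  ring

theorem IsMarkovTrace.unique {r q : K} (hr : r ≠ 0) (hz : q - q⁻¹ ≠ 0)
    {tr tr' : ∀ n, CHat r q n →ₗ[K] K} (h : IsMarkovTrace r q tr) (h' : IsMarkovTrace r q tr') :
    tr = tr' := by
  funext n
  induction n with
  | zero =>
    ext a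
    obtain ⟨c, rfl⟩ := eq_algebraMap_of_le_one zero_le_one a
    rw [Algebra.algebraMap_eq_smul_one, map_smul, map_smul, h.tr_one, h'.tr_one]
  | succ n ih =>
    refine LinearMap.ext_on (topSpan_eq_top hr hz n) ?_
    rintro _ ⟨a, x, b, rfl | ⟨i, hi, hx⟩, rfl⟩
    · rw [mul_one, ← map_mul, h.tr_incl, h'.tr_incl, ih]
    · have hn : 1 ≤ n := hi ▸ i.2.1
      obtain rfl : i = Idx.last hn := Subtype.ext hi
      rcases hx with rfl | rfl
      · rw [h.tr_mul_T_mul, h'.tr_mul_T_mul, ih]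
      · rw [h.tr_mul_E_mul, h'.tr_mul_E_mul, ih]

theorem markovTrace_eq {r q : K} (hr : r ≠ 0) (hz : q - q⁻¹ ≠ 0)
    {tr : ∀ n, CHat r q n →ₗ[K] K} (h : IsMarkovTrace r q tr) : markovTrace r q = tr := by
  have h' : ∃ tr, IsMarkovTrace r q tr := ⟨tr, h⟩
  rw [markovTrace, dif_pos h']
  exact h'.choose_spec.unique hr hz h

theorem isMarkovTrace_or_eq_zero (r q : K) :
    IsMarkovTrace r q (markovTrace r q) ∨ markovTrace r q = 0 := by
  by_cases h : ∃ tr, IsMarkovTrace r q tr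
  · rw [markovTrace, dif_pos h]
    exact Or.inl h.choose_spec
  · exact Or.inr (dif_neg h)

/-- The parameter x and the E_n are unchanged, so only the value on -T_n⁻¹ = -T_n + z(1 - E_n)
matters. It is (-r' + z(x - 1))/x = r/x, because z(x - 1) = r + r'. -/
theorem IsMarkovTrace.flip {r r' q : K} (h : r * r' = -1) (hz : q - q⁻¹ ≠ 0)
    (hx : xParam r q ≠ 0) {tr : ∀ n, CHat r' q n →ₗ[K] K} (htr : IsMarkovTrace r' q tr) :
    IsMarkovTrace r q fun n => (tr n).comp (flip h q n).toLinearMap where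
  tr_mul_comm n a b := by simp [htr.tr_mul_comm n (QBrauer.flip h q n a)]
  tr_one n := by simp [htr.tr_one]
  tr_incl n a := by simp [flip_incl, htr.tr_incl]
  tr_mul_T_mul n hn a b := by
    have hx' : (r' - r'⁻¹) / (q - q⁻¹) + 1 ≠ 0 := by
      rw [← xParam, xParam_flip h]; exact hx
    have hr := inv_eq_neg_of_mul_eq_neg_one (mul_comm_eq_neg_one h)
    simp only [LinearMap.comp_apply, AlgHom.toLinearMap_apply, map_mul, flip_incl, flip_T]
    rw [Tinv_eq hz]
    simp only [mul_neg, neg_mul, mul_sub, sub_mul, mul_smul_comm, smul_mul_assoc, map_neg, map_sub,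
      map_smul, mul_one, ← map_mul (incl r' q n)]
    rw [htr.tr_mul_T_mul, htr.tr_mul_E_mul, htr.tr_incl, ← xParam_flip h, xParam, hr, smul_eq_mul]
    rw [hr] at hx'
    generalize q - q⁻¹ = z at hz hx' ⊢
    -- This is z x, the denominator that remains once fractions are cleared.
    have hx'' : r' - -r + z ≠ 0 := by
      intro h0
      apply hx'
      rw [div_add_one hz, h0, zero_div]
    field_simp
    ring
  tr_mul_E_mul n hn a b := by
    simp [flip_incl, htr.tr_mul_E_mul, xParam_flip h]

/-- Uniqueness applied to a pulled-back trace, on whichever side a Markov trace exists; otherwise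
both functionals are the default 0. -/
theorem markovTrace_flip {r r' q : K} (h : r * r' = -1) (hz : q - q⁻¹ ≠ 0)
    (hx : xParam r q ≠ 0) (n : ℕ) (a : CHat r q n) :
    markovTrace r' q n (flip h q n a) = markovTrace r q n a := by
  have hr := ne_zero_of_mul_eq_neg_one h
  have hr' := ne_zero_of_mul_eq_neg_one (mul_comm_eq_neg_one h)
  rcases isMarkovTrace_or_eq_zero r' q with h1 | h1
  · rw [markovTrace_eq hr hz (h1.flip h hz hx)]
    rfl
  · rcases isMarkovTrace_or_eq_zero r q with h2 | h2
    · rw [← xParam_flip h] at hx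
      rw [markovTrace_eq hr' hz (h2.flip (mul_comm_eq_neg_one h) hz hx)]
      simp
    · rw [h1, h2]
      rfl

/-! ### The quotients by the annihilator of the trace -/

theorem mem_annIdeal {r q : K} {n : ℕ} {a : CHat r q n} :
    a ∈ annIdeal r q n ↔ ∀ b, markovTrace r q n (a * b) = 0 := Iff.rfl

theorem flip_mem_annIdeal {r r' q : K} (h : r * r' = -1) (hz : q - q⁻¹ ≠ 0)
    (hx : xParam r q ≠ 0) {n : ℕ} {a : CHat r q n} (ha : a ∈ annIdeal r q n) :
    flip h q n a ∈ annIdeal r' q n := fun b => by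
  have := markovTrace_flip h hz hx n (a * flip (mul_comm_eq_neg_one h) q n b)
  rwa [map_mul, flip_flip, ha] at this

/-- Pairing a with b χ c on n + 1 strands gives tr(abc) tr(χ), so the larger algebra tests nothing
new. If the trace is the default 0, both ideals are everything. -/
theorem incl_mem_annIdeal {r q : K} (hr : r ≠ 0) (hz : q - q⁻¹ ≠ 0) {n : ℕ} {a : CHat r q n} :
    incl r q n a ∈ annIdeal r q (n + 1) ↔ a ∈ annIdeal r q n := by
  rcases isMarkovTrace_or_eq_zero r q with h | h
  · constructor
    · intro ha b
      rw [← h.tr_incl, map_mul]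
      exact ha _
    · intro ha w
      have hw : w ∈ topSpan r q n := topSpan_eq_top hr hz n ▸ Submodule.mem_top
      induction hw using Submodule.span_induction with
      | zero => simp
      | add y z _ _ hy hz => rw [mul_add, map_add, hy, hz, add_zero]
      | smul c y _ hy => rw [mul_smul_comm, map_smul, hy, smul_zero]
      | mem w hw =>
        obtain ⟨b, x, c, rfl | ⟨i, hi, hx⟩, rfl⟩ := hw
        · rw [mul_one, ← map_mul, ← map_mul, h.tr_incl]
          exact ha _
        · have hn : 1 ≤ n := hi ▸ i.2.1
          obtain rfl : i = Idx.last hn := Subtype.ext hi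
          rw [← mul_assoc, ← mul_assoc, ← map_mul]
          rcases hx with rfl | rfl
          · rw [h.tr_mul_T_mul, mul_assoc, ha, zero_mul]
          · rw [h.tr_mul_E_mul, mul_assoc, ha, zero_mul]
  · simp [mem_annIdeal, h]

/-- The standard inclusions `C̄_n(M,ℓ) ⊆ C̄_{n+1}(M,ℓ)` exist. -/
theorem exists_isStandardInclusion {q : K} (M : ℤ) (hq : q ≠ 0) (hz : q - q⁻¹ ≠ 0) :
    ∃ j : ∀ n, CBar q M n →ₐ[K] CBar q M (n + 1), IsStandardInclusion q M j := by
  have hr : q ^ (M - 1) ≠ 0 := zpow_ne_zero _ hq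
  refine ⟨fun n => Ideal.quotientMapₐ _ (incl (q ^ (M - 1)) q n)
    fun a ha => (incl_mem_annIdeal hr hz).2 ha, fun n => ⟨?_, fun a => rfl⟩⟩
  rw [injective_iff_map_eq_zero]
  intro a ha
  obtain ⟨a, rfl⟩ := Ideal.Quotient.mk_surjective a
  exact Ideal.Quotient.eq_zero_iff_mem.2
    ((incl_mem_annIdeal hr hz).1 (Ideal.Quotient.eq_zero_iff_mem.1 ha))

theorem map_annIdeal {r r' q : K} (h : r * r' = -1) (hz : q - q⁻¹ ≠ 0) (hx : xParam r q ≠ 0)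
    (n : ℕ) : annIdeal r' q n =
      (annIdeal r q n).map (flipEquiv h q n : CHat r q n →+* CHat r' q n) := by
  refine le_antisymm (fun b hb => ?_) (Ideal.map_le_iff_le_comap.2 fun a ha =>
    flip_mem_annIdeal h hz hx ha)
  have h1 := flip_mem_annIdeal (mul_comm_eq_neg_one h) hz (by rwa [xParam_flip h]) hb
  simpa using Ideal.mem_map_of_mem (flipEquiv h q n : CHat r q n →+* CHat r' q n) h1

theorem levelRankIso_of_mul_eq_neg_one {q : K} {M M' : ℤ} (hq : q ≠ 0) (hz : q - q⁻¹ ≠ 0)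
    (h : q ^ (M - 1) * q ^ (M' - 1) = -1) (hx : xParam (q ^ (M - 1)) q ≠ 0) :
    LevelRankIso q M M' := by
  obtain ⟨j, hj⟩ := exists_isStandardInclusion M hq hz
  obtain ⟨j', hj'⟩ := exists_isStandardInclusion M' hq hz
  refine ⟨flipEquiv h q, fun n i => flip_T h q i, markovTrace_flip h hz hx,
    fun n => Ideal.quotientEquivAlg _ _ (flipEquiv h q n) (map_annIdeal h hz hx n),
    fun n a => rfl, j, j', hj, hj', fun n a => ?_⟩
  obtain ⟨a, rfl⟩ := Ideal.Quotient.mk_surjective a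
  exact (congrArg _ ((hj n).2 a)).trans
    ((congrArg (toCBar q M' (n + 1)) (flip_incl h q a)).trans ((hj' n).2 _).symm)

/-! ### Nonvanishing of x and arithmetic of the root of unity -/

theorem xParam_ne_zero {r q : K} (hr : r ≠ 0) (hq : q ≠ 0) (hz : q - q⁻¹ ≠ 0)
    (h1 : r * q ≠ 1) (h2 : r ≠ -q) : xParam r q ≠ 0 := by
  intro h
  rw [xParam, div_add_one hz, div_eq_zero_iff, or_iff_left hz] at h
  -- The numerator of x factors: r - r⁻¹ + q - q⁻¹ = (rq - 1)(r + q)/(rq).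
  have h3 : (r * q - 1) * (r + q) = 0 := by
    field_simp at h
    linear_combination h
  rcases mul_eq_zero.1 h3 with h4 | h4
  · exact h1 (sub_eq_zero.1 h4)
  · exact h2 (eq_neg_of_add_eq_zero_left h4)

/-- The level-rank isomorphism for a primitive root of unity of even order `2m`. -/
theorem levelRankIso_of_isPrimitiveRoot {q : K} {m : ℕ} {M M' : ℤ} (hm : 1 < m)
    (hq : IsPrimitiveRoot q (2 * m)) (hM : ¬ ((2 * m : ℕ) : ℤ) ∣ M)
    (hM2 : ¬ ((2 * m : ℕ) : ℤ) ∣ M - 2 - m) (hMM : ((2 * m : ℕ) : ℤ) ∣ M + M' - 2 - m) :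
    LevelRankIso q M M' := by
  have h0 : q ≠ 0 := hq.ne_zero (by omega)
  have hqm : q ^ (m : ℤ) = -1 := by
    rw [zpow_natCast]
    refine (sq_eq_one_iff.1 ?_).resolve_left (hq.pow_ne_one_of_pos_of_lt (by omega) (by omega))
    rw [← pow_mul, mul_comm, hq.pow_eq_one]
  have hz : q - q⁻¹ ≠ 0 :=
    sub_inv_ne_zero h0 (hq.pow_ne_one_of_pos_of_lt two_ne_zero (by omega))
  -- With r = q^(M-1) and q^m = -1, the zeros rq = 1 and r = -q of x read 2m ∣ M and 2m ∣ M - 2 - m.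
  refine levelRankIso_of_mul_eq_neg_one h0 hz ?_
    (xParam_ne_zero (zpow_ne_zero _ h0) h0 hz (fun h => hM ?_) fun h => hM2 ?_)
  · have h1 := (hq.zpow_eq_one_iff_dvd _).2 hMM
    rw [← zpow_add₀ h0, ← hqm, show M - 1 + (M' - 1) = M + M' - 2 - m + m by ring, zpow_add₀ h0, h1,
      one_mul]
  · rw [← hq.zpow_eq_one_iff_dvd, ← h, ← zpow_add_one₀ h0, sub_add_cancel]
  · rw [← hq.zpow_eq_one_iff_dvd, show M - 2 - m = M - 1 - 1 - m by ring, zpow_sub₀ h0,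
      zpow_sub_one₀ h0, h, hqm]
    field_simp

end QBrauer
end

theorem lemma2p5 {K : Type u} [Field K] [CharZero K] :
    -- (a) the isomorphism, the simple components and the Markov trace
    (∀ r q : K, r ≠ 0 → q ≠ 0 → q ^ 2 ≠ 1 →
      ∃ φ : ∀ n, QBrauer.CHat (-r⁻¹) q n ≃ₐ[K] QBrauer.CHat r q n,
        (∀ n (i : QBrauer.Idx n), φ n (QBrauer.T (-r⁻¹) q i) = -QBrauer.Tinv r q i) ∧
        (∀ n (lam : YoungDiagram),
          φ n '' (QBrauer.component (-r⁻¹) q n lam : Set (QBrauer.CHat (-r⁻¹) q n)) =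
            (QBrauer.component r q n lam.transpose : Set (QBrauer.CHat r q n))) ∧
        (QBrauer.xParam r q ≠ 0 → ∀ n (a : QBrauer.CHat (-r⁻¹) q n),
          QBrauer.markovTrace r q n (φ n a) = QBrauer.markovTrace (-r⁻¹) q n a)) ∧
    -- (b) orthogonal case
    (∀ (l : ℕ) (M : ℤ) (q : K), IsPrimitiveRoot q (2 * l) → 1 < M → M < l →
      QBrauer.LevelRankIso q M (l + 2 - M)) ∧
    -- (c) symplectic case
    (∀ (l : ℕ) (M : ℤ) (q : K), IsPrimitiveRoot q (4 * l) → -2 * l < M → M < -1 → Even M →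
      M ≠ 2 - 2 * l →
      QBrauer.LevelRankIso q M (-2 * l + |M| + 2)) := by
  refine ⟨fun r q hr hq hq2 => ?_, fun l M q hq h1 h2 => ?_, fun l M q hq h1 h2 _ h3 => ?_⟩
  · have h : -r⁻¹ * r = -1 := by rw [neg_mul, inv_mul_cancel₀ hr]
    exact ⟨QBrauer.flipEquiv h q, fun n i => QBrauer.flip_T h q i,
      QBrauer.flipEquiv_image_component h hq, fun hx =>
      QBrauer.markovTrace_flip h (QBrauer.sub_inv_ne_zero hq hq2) (by
        rwa [← QBrauer.xParam_flip h])⟩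
  · refine QBrauer.levelRankIso_of_isPrimitiveRoot (m := l) (by omega) hq ?_ ?_ ?_
    · exact fun h => absurd (Int.le_of_dvd (by omega) h) (by push_cast; omega)
    · rintro ⟨k, hk⟩
      have h4 : -1 < k := by
        by_contra! hc
        push_cast at hk
        nlinarith
      have h5 : k < 0 := by
        by_contra! hc
        push_cast at hk
        nlinarith
      omega
    · exact ⟨0, by ring⟩
  · have hq' : IsPrimitiveRoot q (2 * (2 * l)) := by rwa [← mul_assoc]
    refine QBrauer.levelRankIso_of_isPrimitiveRoot (m := 2 * l) (by omega) hq' ?_ ?_ ?_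
    · rintro ⟨k, hk⟩
      have h4 : -1 < k := by
        by_contra! hc
        push_cast at hk
        nlinarith
      have h5 : k < 0 := by
        by_contra! hc
        push_cast at hk
        nlinarith
      omega
    · rintro ⟨k, hk⟩
      -- The bounds on M leave only M - 2 - 2l = -4l, that is, the excluded value M = 2 - 2l, where
      -- x = 0.
      obtain rfl : k = -1 := by
        push_cast at hk
        have h4 : -2 < k := by
          by_contra! hc
          nlinarith
        have h5 : k < 0 := by
          by_contra! hc
          nlinarith
        omega
      push_cast at hk
      omega
    -- As |M| = -M, the two parameters sum to 2 - 2l, so the dividend is -4l.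
    · refine ⟨-1, ?_⟩
      rw [abs_of_neg (by omega)]
      push_cast
      ring
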